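/- Let $n\ge 1$ and $r\ge 0$ be integers and let $\mathbf Z_n\subset\mathbf C^\times$ be the group of $n$-th roots of unity. Let $\mathbf C^\infty=\bigcup_s\mathbf C^s$ be the space of finitely supported complex sequences with the colimit topology, and let $M=\mathbf C^\infty$ be the $\mathbf Z_n$-module with $\gamma\cdot(z_1,z_2,\dots)=(\gamma z_1,\gamma^2z_2,\dots)$. Let $V_{r,s}$ be the space of orthonormal $r$-frames in $\mathbf C^s$ and $V_{r,\infty}=\varinjlim_s V_{r,s}$, with the colimit topology, the left action of $\mathbf Z_n\times U(r)$ given by $$(\gamma,a)\cdot(v_1,\dots,v_r)=(w_1,\dots,w_r),\qquad w_j^k=\gamma^k\sum_{i=1}^r\overline{a_{ji}}\,v_i^k ,$$ the resulting $\mathbf Z_n$-action $\gamma\cdot v=(\gamma,I_r)\cdot v$ and the right $U(r)$-action $v\cdot a=(1,a^{-1})\cdot v$. Let $G_{r,\infty}$ be the set of $r$-dimensional subspaces of $M$, with the quotient topology of the map $V_{r,\infty}\to G_{r,\infty}$, $(v_1,\dots,v_r)\mapsto\langle v_1,\dots,v_r\rangle$, and the induced $\mathbf Z_n$-action. Let $$E_M=\{(N,z):z\in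 N\}\subseteq G_{r,\infty}\times M$$ with the subspace topology and $\gamma(N,z)=(\gamma N,\gamma z)$. Let $V_{r,\infty}\times_{U(r)}\mathbf C^r$ be the quotient space of $V_{r,\infty}\times\mathbf C^r$ by the relation $(v\cdot a,y)\sim(v,ay)$, $a\in U(r)$, with $\gamma[v,y]=[\gamma v,y]$, projection $[v,y]\mapsto\langle v_1,\dots,v_r\rangle$, and the vector space structure on its fibres for which $y\mapsto[v,y]$ is linear for every $v$. Then $V_{r,\infty}\to G_{r,\infty}$ is a principal $(\mathbf Z_n;U(r))$-bundle (a locally trivial principal $U(r)$-bundle on which $\mathbf Z_n$ acts by bundle maps); the associated bundle $V_{r,\infty}\times_{U(r)}\mathbf C^r\to G_{r,\infty}$ and the canonical bundle $E_M\to G_{r,\infty}$ are $\mathbf Z_n$-equivariant (locally trivial) complex vector bundles; and the formula $$f\big[(v_1,\dots,v_r),y\big]=\Big(\langle v_1,\dots,v_r\rangle,\ \sum_{i=1}^r y_iv_i\Big)$$ defines an isomorphism of $\mathbf Z_n$-vector bundles over $G_{r,\infty}$ from $V_{r,\infty}\times_{U(r)}\mathbf C^r$ to $E_M$, that is, a $\mathbf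 Z_n$-equivariant homeomorphism which is a linear isomorphism from each fibre onto the fibre over the same point. -/

import Mathlib

open Bundle ComplexConjugate

namespace SegalBundle

noncomputable section

/-! ### The groups -/

/-- The cyclic group of order `n`, realised as the group of complex `n`-th roots of unity.  (It is
finite, so an action of it is continuous as soon as each of its elements acts continuously.) -/
def Zn (n : ℕ) : Type := rootsOfUnity n ℂ

instance (n : ℕ) : CommGroup (Zn n) := inferInstanceAs (CommGroup (rootsOfUnity n ℂ))

/-- The complex number underlying an element of the cyclic group. -/
def Zn.val {n : ℕ} (γ : Zn n) : ℂ := ((γ : rootsOfUnity n ℂ).1 : ℂˣ)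

@[simp] theorem Zn.val_one {n : ℕ} : (1 : Zn n).val = 1 := rfl

@[simp] theorem Zn.val_mul {n : ℕ} (γ δ : Zn n) : (γ * δ).val = γ.val * δ.val := rfl

theorem Zn.norm_val {n : ℕ} [NeZero n] (γ : Zn n) : ‖γ.val‖ = 1 :=
  Complex.norm_eq_one_of_mem_rootsOfUnity (γ : rootsOfUnity n ℂ).2

theorem Zn.conj_pow_mul {n : ℕ} [NeZero n] (γ : Zn n) (k : ℕ) :
    conj (γ.val ^ k) * γ.val ^ k = 1 := by
  rw [mul_comm, Complex.mul_conj, Complex.normSq_eq_norm_sq, norm_pow, γ.norm_val]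
  simp

/-- The unitary group `U(r)`, with the topology inherited from the space of matrices. -/
abbrev U (r : ℕ) := Matrix.unitaryGroup (Fin r) ℂ

/-! ### The space `ℂ^∞` -/

/-- `ℂ^∞ = ⋃ ℂ^s`: finitely supported complex sequences.  The index `k : ℕ` stands for the
coordinate number `k + 1`. -/
abbrev CInf := ℕ →₀ ℂ

/-- The inclusion `ℂ^s ⊆ ℂ^∞`. -/
def incl (s : ℕ) : EuclideanSpace ℂ (Fin s) →ₗ[ℂ] CInf :=
  Finsupp.lmapDomain ℂ ℂ Fin.val ∘ₗ (Finsupp.linearEquivFunOnFinite ℂ ℂ (Fin s)).symm.toLinearMap ∘ₗ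
    (WithLp.linearEquiv 2 ℂ (Fin s → ℂ)).toLinearMap

theorem incl_apply (s : ℕ) (z : EuclideanSpace ℂ (Fin s)) (k : Fin s) : incl s z k = z k := by
  simp only [incl, LinearMap.comp_apply, Finsupp.lmapDomain_apply]
  rw [Finsupp.mapDomain_apply Fin.val_injective]
  rfl

theorem incl_apply_of_le (s : ℕ) (z : EuclideanSpace ℂ (Fin s)) (k : ℕ) (hk : s ≤ k) :
    incl s z k = 0 := by
  simp only [incl, LinearMap.comp_apply, Finsupp.lmapDomain_apply]
  refine Finsupp.mapDomain_of_notMem_range _ _ ?_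
  rintro ⟨i, rfl⟩
  omega

/-- `ℂ^∞` has the colimit topology of the spaces `ℂ^s`. -/
instance : TopologicalSpace CInf :=
  ⨆ s : ℕ, TopologicalSpace.coinduced (incl s) inferInstance

/-- The standard Hermitian product of `ℂ^∞`, conjugate linear in the first variable. -/
def herm (z w : CInf) : ℂ := z.sum fun k a => conj a * w k

theorem herm_eq_sum (z w : CInf) (s : Finset ℕ) (hs : z.support ⊆ s) :
    herm z w = ∑ k ∈ s, conj (z k) * w k :=
  Finsupp.sum_of_support_subset _ hs _ (by simp)

theorem herm_add_right (z w w' : CInf) : herm z (w + w') = herm z w + herm z w' := by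
  simp [herm, mul_add, Finsupp.sum_add]

theorem herm_smul_right (c : ℂ) (z w : CInf) : herm z (c • w) = c * herm z w := by
  simp only [herm, Finsupp.sum, Finset.mul_sum]
  refine Finset.sum_congr rfl fun k _ => ?_
  simp only [Finsupp.smul_apply, smul_eq_mul]
  ring

theorem conj_herm (z w : CInf) : conj (herm w z) = herm z w := by
  rw [herm_eq_sum z w (z.support ∪ w.support) Finset.subset_union_left,
    herm_eq_sum w z (z.support ∪ w.support) Finset.subset_union_right, map_sum]
  refine Finset.sum_congr rfl fun k _ => ?_
  simp [mul_comm]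

theorem herm_self (z : CInf) : herm z z = ((∑ k ∈ z.support, ‖z k‖ ^ 2 : ℝ) : ℂ) := by
  rw [herm_eq_sum z z z.support subset_rfl]
  push_cast
  refine Finset.sum_congr rfl fun k _ => ?_
  rw [mul_comm, Complex.mul_conj, Complex.normSq_eq_norm_sq]
  push_cast
  rfl

/-- `herm z` as a linear form. -/
def hermL (z : CInf) : CInf →ₗ[ℂ] ℂ where
  toFun := herm z
  map_add' := herm_add_right z
  map_smul' c w := herm_smul_right c z w

theorem herm_sum_right {ι : Type*} (s : Finset ι) (c : ι → ℂ) (z : CInf) (w : ι → CInf) :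
    herm z (∑ i ∈ s, c i • w i) = ∑ i ∈ s, c i * herm z (w i) := by
  refine (map_sum (hermL z) (fun i => c i • w i) s).trans ?_
  exact Finset.sum_congr rfl fun i _ => herm_smul_right _ _ _

theorem herm_sum_left {ι : Type*} (s : Finset ι) (c : ι → ℂ) (z : CInf) (w : ι → CInf) :
    herm (∑ i ∈ s, c i • w i) z = ∑ i ∈ s, conj (c i) * herm (w i) z := by
  rw [← conj_herm, herm_sum_right, map_sum]
  refine Finset.sum_congr rfl fun k _ => ?_
  rw [map_mul, conj_herm]

/-- The inclusion `ℂ^s ⊆ ℂ^∞` preserves Hermitian products. -/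
theorem herm_incl (s : ℕ) (z w : EuclideanSpace ℂ (Fin s)) :
    herm (incl s z) (incl s w) = inner ℂ z w := by
  rw [herm_eq_sum _ _ (Finset.range s), ← Fin.sum_univ_eq_sum_range
    (fun k => conj (incl s z k) * incl s w k), PiLp.inner_apply]
  · refine Finset.sum_congr rfl fun k _ => ?_
    rw [incl_apply, incl_apply, RCLike.inner_apply, mul_comm]
  · intro k hk
    by_contra h
    exact (Finsupp.mem_support_iff.1 hk) (incl_apply_of_le s z k (by simpa using h))

/-- The `Z_n`-module `M`: the vector space `ℂ^∞` on which `γ` acts by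
`γ (z_1, z_2, …) = (γ z_1, γ² z_2, …)`. -/
def repM (n : ℕ) : Representation ℂ (Zn n) CInf where
  toFun γ :=
    { toFun := fun z => Finsupp.onFinset z.support (fun k => γ.val ^ (k + 1) * z k)
        (fun k hk => Finsupp.mem_support_iff.2 (right_ne_zero_of_mul hk))
      map_add' := fun z w => by ext k; simp [mul_add]
      map_smul' := fun c z => by ext k; simp [mul_left_comm] }
  map_one' := by ext; simp
  map_mul' γ δ := by ext; simp [mul_pow, mul_assoc]

theorem repM_apply {n : ℕ} (γ : Zn n) (z : CInf) (k : ℕ) :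
    repM n γ z k = γ.val ^ (k + 1) * z k := rfl

theorem support_repM {n : ℕ} (γ : Zn n) (z : CInf) : (repM n γ z).support ⊆ z.support := by
  intro k hk
  rw [Finsupp.mem_support_iff, repM_apply] at hk
  exact Finsupp.mem_support_iff.2 (right_ne_zero_of_mul hk)

theorem herm_repM {n : ℕ} [NeZero n] (γ : Zn n) (z w : CInf) :
    herm (repM n γ z) (repM n γ w) = herm z w := by
  rw [herm_eq_sum (repM n γ z) _ z.support (support_repM γ z),
    herm_eq_sum z w z.support subset_rfl]
  refine Finset.sum_congr rfl fun k _ => ?_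
  rw [repM_apply, repM_apply, map_mul]
  linear_combination (conj (z k) * w k) * γ.conj_pow_mul (k + 1)

/-! ### Stiefel manifolds -/

/-- The finite Stiefel manifold `V_{r,s}` of orthonormal `r`-frames in `ℂ^s`. -/
abbrev StiefelFin (r s : ℕ) := {v : Fin r → EuclideanSpace ℂ (Fin s) // Orthonormal ℂ v}

/-- The Stiefel manifold `V_{r,∞}` of orthonormal `r`-frames in `ℂ^∞`. -/
@[ext]
structure Stiefel (r : ℕ) : Type where
  frame : Fin r → CInf
  herm_frame : ∀ i j, herm (frame i) (frame j) = if i = j then 1 else 0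

/-- The inclusion `V_{r,s} ⊆ V_{r,∞}`. -/
def stiefelIncl (r s : ℕ) (v : StiefelFin r s) : Stiefel r :=
  ⟨fun i => incl s (v.1 i), fun i j => by
    rw [herm_incl]; exact (orthonormal_iff_ite.1 v.2) i j⟩

/-- `V_{r,∞}` has the colimit topology of the spaces `V_{r,s}`. -/
instance (r : ℕ) : TopologicalSpace (Stiefel r) :=
  ⨆ s : ℕ, TopologicalSpace.coinduced (stiefelIncl r s) inferInstance

/-- As a set, `V_{r,∞}` is the union of the `V_{r,s}`. -/
theorem exists_stiefelIncl {r : ℕ} (v : Stiefel r) : ∃ s u, stiefelIncl r s u = v := by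
  let s : ℕ := (Finset.univ.biUnion fun i => (v.1 i).support).sup id + 1
  have hs : ∀ i k, s ≤ k → v.1 i k = 0 := by
    intro i k hk
    by_contra h
    have hm : k ∈ Finset.univ.biUnion fun i => (v.1 i).support :=
      Finset.mem_biUnion.2 ⟨i, Finset.mem_univ _, Finsupp.mem_support_iff.2 h⟩
    have := Finset.le_sup (f := id) hm
    simp only [id] at this
    omega
  let u : Fin r → EuclideanSpace ℂ (Fin s) := fun i => WithLp.toLp 2 fun k => v.1 i k
  have hu : ∀ i, incl s (u i) = v.1 i := by
    intro i
    ext k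
    by_cases hk : k < s
    · exact incl_apply s (u i) ⟨k, hk⟩
    · rw [incl_apply_of_le s _ k (by omega), hs i k (by omega)]
  refine ⟨s, ⟨u, ?_⟩, Stiefel.ext (funext hu)⟩
  rw [orthonormal_iff_ite]
  intro i j
  rw [← herm_incl, hu, hu, v.2 i j]

theorem Stiefel.herm_comb {r : ℕ} (v : Stiefel r) (y : Fin r → ℂ) (j : Fin r) :
    herm (v.1 j) (∑ i, y i • v.1 i) = y j := by
  rw [herm_sum_right]
  simp [v.2]

theorem Stiefel.linearIndependent {r : ℕ} (v : Stiefel r) : LinearIndependent ℂ v.1 := by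
  rw [Fintype.linearIndependent_iff]
  intro g hg i
  rw [← v.herm_comb g i, hg]
  simp [herm]

theorem herm_comb_comb {r : ℕ} (v : Stiefel r) (x y : Fin r → ℂ) :
    herm (∑ i, x i • v.1 i) (∑ i, y i • v.1 i) = ∑ i, conj (x i) * y i := by
  rw [herm_sum_left]
  simp only [v.herm_comb]

/-- The action of `(γ, a) ∈ Z_n × U(r)` on a frame: `w_j^k = γ^k ∑_i conj (a_{ji}) v_i^k`. -/
def Stiefel.act {n r : ℕ} [NeZero n] (γ : Zn n) (a : U r) (v : Stiefel r) : Stiefel r :=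
  ⟨fun j => repM n γ (∑ i, conj (a.1 j i) • v.1 i), fun i j => by
    rw [herm_repM, herm_comb_comb]
    have h := congrFun (congrFun (Matrix.mem_unitaryGroup_iff.1 a.2) i) j
    rw [Matrix.mul_apply, Matrix.one_apply] at h
    rw [← h]
    simp [Matrix.star_apply]⟩

theorem Stiefel.act_apply {n r : ℕ} [NeZero n] (γ : Zn n) (a : U r) (v : Stiefel r)
    (j : Fin r) (k : ℕ) :
    (Stiefel.act γ a v).1 j k = γ.val ^ (k + 1) * ∑ i, conj (a.1 j i) * v.1 i k := by
  simp only [Stiefel.act, repM_apply, Finsupp.finsetSum_apply, Finsupp.smul_apply, smul_eq_mul]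

/-- The left action of `Z_n × U(r)` on `V_{r,∞}`. -/
instance (n r : ℕ) [NeZero n] : MulAction (Zn n × U r) (Stiefel r) where
  smul g v := Stiefel.act g.1 g.2 v
  one_smul v := by
    refine Stiefel.ext (funext fun j => Finsupp.ext fun k => ?_)
    refine (Stiefel.act_apply _ _ v j k).trans ?_
    simp [Matrix.one_apply]
  mul_smul g h v := by
    refine Stiefel.ext (funext fun j => Finsupp.ext fun k => ?_)
    refine (Stiefel.act_apply _ _ v j k).trans ?_
    refine Eq.trans ?_ (Stiefel.act_apply _ _ (Stiefel.act h.1 h.2 v) j k).symm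
    simp only [Stiefel.act_apply, Prod.fst_mul, Prod.snd_mul, Zn.val_mul, mul_pow,
      Submonoid.coe_mul, Matrix.mul_apply, map_sum, map_mul, Finset.sum_mul, Finset.mul_sum]
    rw [Finset.sum_comm]
    refine Finset.sum_congr rfl fun i _ => Finset.sum_congr rfl fun l _ => ?_
    ring

theorem Stiefel.smul_def {n r : ℕ} [NeZero n] (g : Zn n × U r) (v : Stiefel r) :
    g • v = Stiefel.act g.1 g.2 v := rfl

/-- The action of `Z_n` on `V_{r,∞}`: `γ • v = (γ, 1) • v`. -/
instance (n r : ℕ) [NeZero n] : MulAction (Zn n) (Stiefel r) :=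
  MulAction.compHom (Stiefel r) (MonoidHom.inl (Zn n) (U r))

theorem Stiefel.zn_smul_def {n r : ℕ} [NeZero n] (γ : Zn n) (v : Stiefel r) :
    γ • v = ((γ, 1) : Zn n × U r) • v := rfl

theorem Stiefel.zn_smul_val {n r : ℕ} [NeZero n] (γ : Zn n) (v : Stiefel r) (j : Fin r) :
    (γ • v).1 j = repM n γ (v.1 j) := by
  ext k
  refine (Stiefel.act_apply _ _ v j k).trans ?_
  simp [Matrix.one_apply, repM_apply]

/-- The right action of `U(r)` on `V_{r,∞}`: `v <• a = (1, a⁻¹) • v`, where `1 ∈ Z_n`.  The choice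
of `n` does not matter, see `Stiefel.right_smul_eq`; here `n = 1`. -/
instance (r : ℕ) : MulAction (U r)ᵐᵒᵖ (Stiefel r) where
  smul a v := (((1 : Zn 1), (MulOpposite.unop a)⁻¹) : Zn 1 × U r) • v
  one_smul v := by
    change (((1 : Zn 1), (MulOpposite.unop (1 : (U r)ᵐᵒᵖ))⁻¹) : Zn 1 × U r) • v = v
    rw [MulOpposite.unop_one, inv_one]
    exact one_smul (Zn 1 × U r) v
  mul_smul a b v := by
    change (((1 : Zn 1), (MulOpposite.unop (a * b))⁻¹) : Zn 1 × U r) • v =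
      (((1 : Zn 1), (MulOpposite.unop a)⁻¹) : Zn 1 × U r) •
        (((1 : Zn 1), (MulOpposite.unop b)⁻¹) : Zn 1 × U r) • v
    rw [smul_smul, Prod.mk_mul_mk, one_mul, MulOpposite.unop_mul, mul_inv_rev]

theorem Stiefel.right_smul_eq (n : ℕ) [NeZero n] {r : ℕ} (v : Stiefel r) (a : U r) :
    MulOpposite.op a • v = (((1 : Zn n), a⁻¹) : Zn n × U r) • v := by
  refine Stiefel.ext (funext fun j => Finsupp.ext fun k => ?_)
  refine (Stiefel.act_apply (1 : Zn 1) a⁻¹ v j k).trans ?_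
  refine Eq.trans ?_ (Stiefel.act_apply (1 : Zn n) a⁻¹ v j k).symm
  simp

theorem Stiefel.right_smul_val {r : ℕ} (v : Stiefel r) (a : U r) (j : Fin r) :
    (MulOpposite.op a • v).1 j = ∑ i, a.1 i j • v.1 i := by
  ext k
  refine (Stiefel.act_apply (1 : Zn 1) a⁻¹ v j k).trans ?_
  simp [Finsupp.finsetSum_apply, ← Unitary.star_eq_inv, Matrix.star_apply]

theorem Stiefel.smul_right_smul {n r : ℕ} [NeZero n] (γ : Zn n) (v : Stiefel r) (a : U r) :
    γ • (MulOpposite.op a • v) = MulOpposite.op a • (γ • v) := by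
  rw [Stiefel.right_smul_eq n, Stiefel.right_smul_eq n, zn_smul_def, zn_smul_def, smul_smul,
    smul_smul]
  simp

/-! ### The Grassmannian -/

/-- The set `G_{r,∞}` of `r`-dimensional subspaces of `M`. -/
@[ext]
structure Grass (r : ℕ) : Type where
  space : Submodule ℂ CInf
  finite : Module.Finite ℂ space
  finrank_eq : Module.finrank ℂ space = r

/-- The projection `V_{r,∞} → G_{r,∞}`, `(v_1, …, v_r) ↦ ⟨v_1, …, v_r⟩`. -/
def Stiefel.span {r : ℕ} (v : Stiefel r) : Grass r :=
  ⟨Submodule.span ℂ (Set.range v.1), Module.Finite.span_of_finite ℂ (Set.finite_range v.1), by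
    rw [finrank_span_eq_card v.linearIndependent, Fintype.card_fin]⟩

/-- `G_{r,∞}` has the quotient topology from `V_{r,∞}`. -/
instance (r : ℕ) : TopologicalSpace (Grass r) :=
  TopologicalSpace.coinduced Stiefel.span inferInstance

/-- The linear automorphism of `M` given by an element of `Z_n`. -/
def repMEquiv {n : ℕ} (γ : Zn n) : CInf ≃ₗ[ℂ] CInf :=
  LinearEquiv.ofLinearMap (repM n γ) (repM n γ⁻¹)
    (by rw [← Module.End.mul_eq_comp, ← map_mul, mul_inv_cancel, map_one]; rfl)
    (by rw [← Module.End.mul_eq_comp, ← map_mul, inv_mul_cancel, map_one]; rfl)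

/-- The action of `Z_n` on `G_{r,∞}` by taking images of subspaces of `M`. -/
instance (n r : ℕ) : MulAction (Zn n) (Grass r) where
  smul γ N := ⟨N.1.map (repM n γ), have := N.finite; Module.Finite.map N.1 _, (LinearEquiv.finrank_map_eq (repMEquiv γ) N.1).trans N.finrank_eq⟩
  one_smul N := Grass.ext (by
    change N.1.map (repM n 1) = N.1
    rw [map_one]
    exact Submodule.map_id N.1)
  mul_smul γ δ N := Grass.ext (by
    change N.1.map (repM n (γ * δ)) = (N.1.map (repM n δ)).map (repM n γ)
    rw [map_mul, ← Submodule.map_comp]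
    rfl)

theorem Grass.smul_val {n r : ℕ} (γ : Zn n) (N : Grass r) : (γ • N).1 = N.1.map (repM n γ) := rfl

theorem Stiefel.span_smul {n r : ℕ} [NeZero n] (γ : Zn n) (v : Stiefel r) :
    (γ • v).span = γ • v.span := by
  refine Grass.ext ?_
  rw [Grass.smul_val]
  simp only [Stiefel.span]
  rw [Submodule.map_span, ← Set.range_comp]
  congr 2
  funext j
  exact Stiefel.zn_smul_val γ v j

/-- Two orthonormal frames with the same span differ by a unitary matrix. -/
theorem Stiefel.exists_right_smul {r : ℕ} (v w : Stiefel r) (h : v.span = w.span) :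
    ∃ a : U r, w = MulOpposite.op a • v := by
  have hw : ∀ j, w.1 j = ∑ i, herm (v.1 i) (w.1 j) • v.1 i := by
    intro j
    have hm : w.1 j ∈ Submodule.span ℂ (Set.range v.1) := by
      have : v.span.1 = w.span.1 := by rw [h]
      simp only [Stiefel.span] at this
      rw [this]
      exact Submodule.subset_span ⟨j, rfl⟩
    obtain ⟨c, hc⟩ := (Submodule.mem_span_range_iff_exists_fun ℂ).1 hm
    have : ∀ i, herm (v.1 i) (w.1 j) = c i := fun i => by rw [← hc, v.herm_comb]
    simp only [this, hc]
  refine ⟨⟨Matrix.of fun i j => herm (v.1 i) (w.1 j), ?_⟩, ?_⟩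
  · rw [Matrix.mem_unitaryGroup_iff']
    ext j k
    rw [Matrix.one_apply, ← w.2 j k]
    conv_rhs => rw [hw j, hw k]
    rw [herm_comb_comb, Matrix.mul_apply]
    rfl
  · refine Stiefel.ext (funext fun j => ?_)
    rw [Stiefel.right_smul_val]
    exact hw j

theorem Stiefel.span_right_smul {r : ℕ} (v : Stiefel r) (a : U r) :
    (MulOpposite.op a • v).span = v.span := by
  have key : ∀ (w : Stiefel r) (b : U r), (MulOpposite.op b • w).span.1 ≤ w.span.1 := by
    intro w b
    refine Submodule.span_le.2 ?_
    rintro _ ⟨j, rfl⟩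
    rw [Stiefel.right_smul_val]
    exact Submodule.sum_mem _ fun i _ =>
      Submodule.smul_mem _ _ (Submodule.subset_span ⟨i, rfl⟩)
  refine Grass.ext (le_antisymm (key v a) ?_)
  have := key (MulOpposite.op a • v) a⁻¹
  rwa [smul_smul, ← MulOpposite.op_mul, mul_inv_cancel, MulOpposite.op_one, one_smul] at this

/-- The Hermitian product as an inner product in the sense of the library. -/
@[reducible]
def hermCore : InnerProductSpace.Core ℂ CInf where
  inner := herm
  conj_inner_symm := conj_herm
  re_inner_nonneg z := by
    rw [herm_self]
    exact (Finset.sum_nonneg fun k _ => sq_nonneg _ : (0 : ℝ) ≤ _)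
  add_left x y z := by
    rw [← conj_herm, herm_add_right, map_add, conj_herm, conj_herm]
  smul_left x y c := by
    rw [← conj_herm, herm_smul_right, map_mul, conj_herm]
  definite z hz := by
    rw [herm_self, Complex.ofReal_eq_zero,
      Finset.sum_eq_zero_iff_of_nonneg fun k _ => sq_nonneg _] at hz
    ext k
    by_contra hk
    have := hz k (Finsupp.mem_support_iff.2 hk)
    simp at this
    exact hk this

theorem Stiefel.span_surjective (r : ℕ) : Function.Surjective (Stiefel.span (r := r)) := by
  rintro ⟨N, hN, hr⟩
  let _ : NormedAddCommGroup CInf := @InnerProductSpace.Core.toNormedAddCommGroup ℂ CInf _ _ _ hermCore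
  let _ : InnerProductSpace ℂ CInf := InnerProductSpace.ofCore hermCore.toCore
  let b := (stdOrthonormalBasis ℂ N).reindex (finCongr hr)
  have hb : ∀ i j, herm (b i : CInf) (b j : CInf) = if i = j then 1 else 0 := fun i j =>
    orthonormal_iff_ite.1 b.orthonormal i j
  refine ⟨⟨fun i => (b i : CInf), hb⟩, Grass.ext ?_⟩
  change Submodule.span ℂ (Set.range fun i => (b i : CInf)) = N
  have h1 : Submodule.span ℂ (Set.range b) = ⊤ := by
    have := b.toBasis.span_eq
    rwa [OrthonormalBasis.coe_toBasis] at this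
  have h2 := congrArg (Submodule.map N.subtype) h1
  rw [Submodule.map_span, Submodule.map_subtype_top, ← Set.range_comp] at h2
  exact h2

/-! ### The associated bundle `V_{r,∞} ×_{U(r)} ℂ^r` -/

/-- The relation `(v a, y) ∼ (v, a y)` on `V_{r,∞} × ℂ^r`. -/
def assocSetoid (r : ℕ) : Setoid (Stiefel r × (Fin r → ℂ)) where
  r p q := ∃ a : U r, p.1 = MulOpposite.op a • q.1 ∧ q.2 = a.1.mulVec p.2
  iseqv :=
    { refl := fun p => ⟨1, by simp⟩
      symm := by
        rintro ⟨v, y⟩ ⟨w, z⟩ ⟨a, h1, h2⟩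
        dsimp only at h1 h2
        subst h1 h2
        refine ⟨a⁻¹, ?_, ?_⟩
        · dsimp only
          rw [smul_smul, ← MulOpposite.op_mul, mul_inv_cancel, MulOpposite.op_one, one_smul]
        · dsimp only
          rw [Matrix.mulVec_mulVec, ← Submonoid.coe_mul, inv_mul_cancel, OneMemClass.coe_one,
            Matrix.one_mulVec]
      trans := by
        rintro ⟨v, y⟩ ⟨w, z⟩ ⟨u, x⟩ ⟨a, h1, h2⟩ ⟨b, h3, h4⟩
        dsimp only at h1 h2 h3 h4
        subst h1 h2 h3 h4
        refine ⟨b * a, ?_, ?_⟩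
        · dsimp only
          rw [MulOpposite.op_mul, mul_smul]
        · dsimp only
          rw [Matrix.mulVec_mulVec, ← Submonoid.coe_mul] }

/-- The total space `V_{r,∞} ×_{U(r)} ℂ^r` of the associated bundle. -/
def Assoc (r : ℕ) : Type := Quotient (assocSetoid r)

/-- The total space carries the quotient topology. -/
instance (r : ℕ) : TopologicalSpace (Assoc r) :=
  inferInstanceAs (TopologicalSpace (Quotient (assocSetoid r)))

/-- The class `[v, y]`. -/
def Assoc.mk {r : ℕ} (v : Stiefel r) (y : Fin r → ℂ) : Assoc r :=
  Quotient.mk (assocSetoid r) (v, y)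

theorem Assoc.mk_right_smul {r : ℕ} (v : Stiefel r) (a : U r) (y : Fin r → ℂ) :
    Assoc.mk (MulOpposite.op a • v) y = Assoc.mk v (a.1.mulVec y) :=
  Quotient.sound ⟨a, rfl, rfl⟩

/-- The bundle projection `[v, y] ↦ ⟨v_1, …, v_r⟩`. -/
def Assoc.proj {r : ℕ} (q : Assoc r) : Grass r :=
  Quotient.lift (fun p : Stiefel r × (Fin r → ℂ) => p.1.span) (by
    rintro ⟨v, y⟩ ⟨w, z⟩ ⟨a, h1, -⟩
    dsimp only at h1 ⊢
    rw [h1, Stiefel.span_right_smul]) q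

@[simp] theorem Assoc.proj_mk {r : ℕ} (v : Stiefel r) (y : Fin r → ℂ) :
    (Assoc.mk v y).proj = v.span := rfl

/-- The action `γ • [v, y] = [γ • v, y]`. -/
instance (n r : ℕ) [NeZero n] : MulAction (Zn n) (Assoc r) where
  smul γ q := Quotient.map (fun p : Stiefel r × (Fin r → ℂ) => (γ • p.1, p.2)) (by
    rintro ⟨v, y⟩ ⟨w, z⟩ ⟨a, h1, h2⟩
    dsimp only at h1 h2
    refine ⟨a, ?_, h2⟩
    dsimp only
    rw [h1, Stiefel.smul_right_smul]) q
  one_smul q := by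
    induction q using Quotient.inductionOn with
    | h p =>
      change Quotient.mk (assocSetoid r) ((1 : Zn n) • p.1, p.2) = Quotient.mk _ p
      rw [one_smul]
  mul_smul γ δ q := by
    induction q using Quotient.inductionOn with
    | h p =>
      change Quotient.mk (assocSetoid r) ((γ * δ) • p.1, p.2) =
        Quotient.mk _ (γ • δ • p.1, p.2)
      rw [mul_smul]

theorem Assoc.smul_mk {n r : ℕ} [NeZero n] (γ : Zn n) (v : Stiefel r) (y : Fin r → ℂ) :
    γ • Assoc.mk v y = Assoc.mk (γ • v) y := rfl

theorem Assoc.proj_smul {n r : ℕ} [NeZero n] (γ : Zn n) (q : Assoc r) :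
    (γ • q).proj = γ • q.proj := by
  induction q using Quotient.inductionOn with
  | h p => exact Stiefel.span_smul γ p.1

/-- The fibre of the associated bundle over `N`. -/
@[ext]
structure AssocFibre (r : ℕ) (N : Grass r) : Type where
  point : Assoc r
  proj_point : point.proj = N

/-- A frame `v` of `N` identifies `ℂ^r` with the fibre over `N`, by `y ↦ [v, y]`. -/
def frameEquiv {r : ℕ} (v : Stiefel r) (N : Grass r) (hv : v.span = N) :
    (Fin r → ℂ) ≃ AssocFibre r N :=
  Equiv.ofBijective (fun y => (⟨Assoc.mk v y, hv⟩ : AssocFibre r N)) (by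
    constructor
    · intro y z h
      obtain ⟨a, h1, h2⟩ := Quotient.exact (congrArg AssocFibre.point h)
      dsimp only at h1 h2
      have ha : a.1 = 1 := by
        refine Matrix.ext fun i j => ?_
        have h3 : herm (v.1 i) (v.1 j) = herm (v.1 i) ((MulOpposite.op a • v).1 j) :=
          congrArg (fun u : Stiefel r => herm (v.1 i) (u.1 j)) h1
        rw [Stiefel.right_smul_val, v.herm_comb, v.2] at h3
        rw [Matrix.one_apply, h3]
      rw [h2, ha, Matrix.one_mulVec]
    · rintro ⟨q, hq⟩
      induction q using Quotient.inductionOn with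
      | h p =>
        obtain ⟨a, ha⟩ := Stiefel.exists_right_smul v p.1 (hv.trans hq.symm)
        refine ⟨a.1.mulVec p.2, AssocFibre.ext ?_⟩
        dsimp only
        rw [← Assoc.mk_right_smul, ← ha]
        rfl)

/-- The vector space structure of the fibre over `N`, transported from `ℂ^r` along a frame of `N`;
it does not depend on the frame, see `AssocFibre.ofFrame_add` and `AssocFibre.ofFrame_smul`. -/
def chosenFrameEquiv (r : ℕ) (N : Grass r) : AssocFibre r N ≃ (Fin r → ℂ) :=
  (frameEquiv (Stiefel.span_surjective r N).choose N
    (Stiefel.span_surjective r N).choose_spec).symm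

instance (r : ℕ) (N : Grass r) : AddCommGroup (AssocFibre r N) :=
  (chosenFrameEquiv r N).addCommGroup

instance (r : ℕ) (N : Grass r) : Module ℂ (AssocFibre r N) :=
  (chosenFrameEquiv r N).module ℂ

/-- The point `[v, y]` in the fibre over the span of `v`. -/
def AssocFibre.ofFrame {r : ℕ} (v : Stiefel r) (y : Fin r → ℂ) : AssocFibre r v.span :=
  ⟨Assoc.mk v y, Assoc.proj_mk v y⟩

theorem exists_mulVec_chosenFrameEquiv {r : ℕ} (v : Stiefel r) :
    ∃ a : U r, ∀ y, chosenFrameEquiv r v.span (AssocFibre.ofFrame v y) = a.1.mulVec y := by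
  obtain ⟨a, ha⟩ := Stiefel.exists_right_smul _ v (Stiefel.span_surjective r v.span).choose_spec
  refine ⟨a, fun y => (Equiv.symm_apply_eq _).2 (AssocFibre.ext ?_)⟩
  change Assoc.mk v y = Assoc.mk _ (a.1.mulVec y)
  rw [← Assoc.mk_right_smul, ← ha]

/-- In every frame, addition in the fibres is `[v, y] + [v, z] = [v, y + z]`. -/
theorem AssocFibre.ofFrame_add {r : ℕ} (v : Stiefel r) (y z : Fin r → ℂ) :
    AssocFibre.ofFrame v y + AssocFibre.ofFrame v z = AssocFibre.ofFrame v (y + z) := by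
  obtain ⟨a, ha⟩ := exists_mulVec_chosenFrameEquiv v
  change (chosenFrameEquiv r v.span).symm (chosenFrameEquiv r v.span (ofFrame v y) +
    chosenFrameEquiv r v.span (ofFrame v z)) = _
  rw [Equiv.symm_apply_eq, ha, ha, ha, Matrix.mulVec_add]

/-- In every frame, scalar multiplication in the fibres is `c • [v, y] = [v, c • y]`. -/
theorem AssocFibre.ofFrame_smul {r : ℕ} (v : Stiefel r) (c : ℂ) (y : Fin r → ℂ) :
    c • AssocFibre.ofFrame v y = AssocFibre.ofFrame v (c • y) := by
  obtain ⟨a, ha⟩ := exists_mulVec_chosenFrameEquiv v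
  change (chosenFrameEquiv r v.span).symm (c • chosenFrameEquiv r v.span (ofFrame v y)) = _
  rw [Equiv.symm_apply_eq, ha, ha, Matrix.mulVec_smul]

/-- The disjoint union of the fibres is `V_{r,∞} ×_{U(r)} ℂ^r`. -/
def assocTotalEquiv (r : ℕ) : TotalSpace (Fin r → ℂ) (AssocFibre r) ≃ Assoc r where
  toFun e := e.2.1
  invFun q := ⟨q.proj, ⟨q, rfl⟩⟩
  left_inv := by rintro ⟨_, ⟨q, rfl⟩⟩; rfl
  right_inv q := rfl

instance (r : ℕ) : TopologicalSpace (TotalSpace (Fin r → ℂ) (AssocFibre r)) :=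
  TopologicalSpace.induced (assocTotalEquiv r) inferInstance

instance (n r : ℕ) [NeZero n] : MulAction (Zn n) (TotalSpace (Fin r → ℂ) (AssocFibre r)) :=
  (assocTotalEquiv r).mulAction (Zn n)

/-! ### The tautological bundle `E_M` -/

/-- The fibre of the tautological bundle over the subspace `N` is `N` itself. -/
abbrev TautFibre (r : ℕ) (N : Grass r) : Type := N.1

/-- The identification `E_M = {(N, z) : z ∈ N} ⊆ G_{r,∞} × M`. -/
def tautToProd (r : ℕ) (e : TotalSpace (Fin r → ℂ) (TautFibre r)) : Grass r × CInf :=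
  (e.1, (e.2 : CInf))

/-- `E_M` has the subspace topology of `G_{r,∞} × M`. -/
instance (r : ℕ) : TopologicalSpace (TotalSpace (Fin r → ℂ) (TautFibre r)) :=
  TopologicalSpace.induced (tautToProd r) inferInstance

theorem tautToProd_injective (r : ℕ) : Function.Injective (tautToProd r) := by
  rintro ⟨N, z, hz⟩ ⟨N', z', hz'⟩ h
  obtain ⟨rfl, h2⟩ := Prod.mk.inj h
  dsimp only at h2
  subst h2
  rfl

/-- The action `γ • (N, z) = (γ N, γ z)`. -/
instance (n r : ℕ) : MulAction (Zn n) (TotalSpace (Fin r → ℂ) (TautFibre r)) where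
  smul γ e := ⟨γ • e.1, ⟨repM n γ (e.2 : CInf), Submodule.mem_map_of_mem e.2.2⟩⟩
  one_smul e := tautToProd_injective r (Prod.ext (one_smul (Zn n) e.1) (by
    change repM n 1 (e.2 : CInf) = e.2
    rw [map_one]
    rfl))
  mul_smul γ δ e := tautToProd_injective r (Prod.ext (mul_smul γ δ e.1) (by
    change repM n (γ * δ) (e.2 : CInf) = repM n γ (repM n δ (e.2 : CInf))
    rw [map_mul]
    rfl))

/-! ### Equivariant bundles and their isomorphisms -/

/-- `p : P → B` is a principal `(Γ; G)`-bundle, for a finite group `Γ`: a locally trivial principal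
`G`-bundle (with right action of `G`) on which `Γ` acts by bundle maps. -/
structure IsEquivariantPrincipalBundle (Γ G : Type*) [Group Γ] [Group G] [TopologicalSpace G]
    {P B : Type*} [TopologicalSpace P] [TopologicalSpace B] [MulAction Γ P] [MulAction Γ B]
    [MulAction Gᵐᵒᵖ P] (p : P → B) : Prop where
  continuous_proj : Continuous p
  continuous_smul_base : ∀ γ : Γ, Continuous fun b : B => γ • b
  continuous_smul : ∀ γ : Γ, Continuous fun x : P => γ • x
  continuous_right_smul : Continuous fun x : P × G => MulOpposite.op x.2 • x.1
  proj_smul : ∀ (γ : Γ) (x : P), p (γ • x) = γ • p x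
  proj_right_smul : ∀ (x : P) (g : G), p (MulOpposite.op g • x) = p x
  smul_right_smul : ∀ (γ : Γ) (x : P) (g : G),
    γ • (MulOpposite.op g • x) = MulOpposite.op g • (γ • x)
  locally_trivial : ∀ b : B, ∃ e : Trivialization G p, b ∈ e.baseSet ∧
    ∀ x : P, p x ∈ e.baseSet → ∀ g : G, (e (MulOpposite.op g • x)).2 = (e x).2 * g

/-- The family `E` of complex vector spaces over `B` (with the given topology and `Γ`-action on
its total space) is a `Γ`-equivariant complex vector bundle with typical fibre `F`, for a finite
group `Γ`: it is locally trivial, `Γ` acts continuously on the base and on the total space, and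
`γ` maps the fibre over `b` linearly to the fibre over `γ b`. -/
structure IsEquivariantVectorBundle (Γ : Type*) [Group Γ] {B : Type*} [TopologicalSpace B]
    [MulAction Γ B] (F : Type*) [NormedAddCommGroup F] [NormedSpace ℂ F] (E : B → Type*)
    [∀ b, AddCommGroup (E b)] [∀ b, Module ℂ (E b)] [TopologicalSpace (TotalSpace F E)]
    [MulAction Γ (TotalSpace F E)] : Prop where
  continuous_proj : Continuous (TotalSpace.proj : TotalSpace F E → B)
  locally_trivial : ∀ b : B, ∃ e : Trivialization F (TotalSpace.proj : TotalSpace F E → B),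
    b ∈ e.baseSet ∧ e.IsLinear ℂ
  continuous_smul_base : ∀ γ : Γ, Continuous fun b : B => γ • b
  continuous_smul : ∀ γ : Γ, Continuous fun x : TotalSpace F E => γ • x
  smul_linear : ∀ (γ : Γ) (b : B), ∃ L : E b →ₗ[ℂ] E (γ • b),
    ∀ x : E b, γ • (⟨b, x⟩ : TotalSpace F E) = ⟨γ • b, L x⟩

/-- `f` is an isomorphism of `Γ`-equivariant complex vector bundles over `B`: a `Γ`-equivariant
homeomorphism of total spaces that maps the fibre over each `b` linearly isomorphically onto the
fibre over the same `b`. -/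
structure IsEquivariantVectorBundleIso (Γ : Type*) [Group Γ] {B : Type*} {F : Type*}
    {E E' : B → Type*} [∀ b, AddCommGroup (E b)] [∀ b, Module ℂ (E b)]
    [∀ b, AddCommGroup (E' b)] [∀ b, Module ℂ (E' b)]
    [TopologicalSpace (TotalSpace F E)] [TopologicalSpace (TotalSpace F E')]
    [MulAction Γ (TotalSpace F E)] [MulAction Γ (TotalSpace F E')]
    (f : TotalSpace F E → TotalSpace F E') : Prop where
  isHomeomorph : IsHomeomorph f
  fibre_linear : ∀ b : B, ∃ L : E b ≃ₗ[ℂ] E' b, ∀ x : E b, f ⟨b, x⟩ = ⟨b, L x⟩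
  equivariant : ∀ (γ : Γ) (x : TotalSpace F E), f (γ • x) = γ • f x

end

end SegalBundle

open SegalBundle

/-! Everything rests on continuous local sections of `Stiefel.span`. Fix a frame v. The subspaces N
for which the Hermitian products of v with a frame w of N form an invertible matrix A make up an
open neighbourhood of the span of v. Replacing w by w·g turns A into A·g, and the unitary factor in
the polar decomposition of A is then multiplied by g as well (`exists_polar`). Dividing w by this
factor leaves a frame that depends on N alone: the section σ of `exists_section`. Since the action
of U(r) is free, writing w = σ(N)·R(w) trivializes the principal bundle.

The section also provides a moving basis of the fibres of E_M. The coordinates C(N, z) of z ∈ N in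
the basis σ(N) solve a linear system with invertible matrix, hence vary continuously
(`exists_coords`). So E_M is locally trivial, and f⁻¹ is locally (N, z) ↦ [σ(N), C(N, z)], hence
continuous. The associated bundle inherits its local triviality from E_M through f
(`IsEquivariantVectorBundle.of_iso`).

The topological difficulty is joint continuity, since a colimit need not commute with products. The
second factors that occur, U(r) and ℂ^r, are locally compact, and there the exponential law applies
(`continuous_uncurry_of_iSup_coinduced`). -/

namespace SegalBundle

/-! ### Polar decomposition of matrices -/

open scoped Matrix.Norms.L2Operator MatrixOrder in
-- The positive square root of A A* works. It is continuous in A by the functional calculus of the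
-- C*-algebra of matrices, and A A* does not change when A is multiplied on the right by a unitary
-- matrix.
theorem exists_continuous_sqrt_mul_star (r : ℕ) :
    ∃ P : Matrix (Fin r) (Fin r) ℂ → Matrix (Fin r) (Fin r) ℂ, Continuous P ∧
      (∀ A, P A * P A = A * star A) ∧ (∀ A, star (P A) = P A) ∧
      ∀ A (g : U r), P (A * g.1) = P A := by
  refine ⟨fun A => CFC.sqrt (A * star A), ?_, fun A => ?_, fun A => ?_, fun A g => ?_⟩
  · exact Continuous.cfcₙ_nnreal_of_mem_nhdsSet (s := Set.univ) NNReal.sqrt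
      Filter.univ_mem (by fun_prop) (fun A => mul_star_self_nonneg A)
      NNReal.continuous_sqrt.continuousOn NNReal.sqrt_zero
  · exact CFC.sqrt_mul_sqrt_self _ (mul_star_self_nonneg A)
  · exact (IsSelfAdjoint.of_nonneg (CFC.sqrt_nonneg (A * star A))).star_eq
  · have h : g.1 * star g.1 = 1 := Matrix.mem_unitaryGroup_iff.1 g.2
    simp only [star_mul]
    rw [mul_assoc, ← mul_assoc g.1, h, one_mul]

theorem isOpen_det_ne_zero (r : ℕ) :
    IsOpen {A : Matrix (Fin r) (Fin r) ℂ | A.det ≠ 0} :=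
  isOpen_ne_fun (by fun_prop) (by fun_prop)

/-- The unitary factor `R A` of the polar decomposition of invertible matrices `A` depends
continuously on `A`. -/
theorem exists_polar (r : ℕ) :
    ∃ R : Matrix (Fin r) (Fin r) ℂ → U r, ContinuousOn R {A | A.det ≠ 0} ∧
      ∀ A (g : U r), A.det ≠ 0 → R (A * g.1) = R A * g := by
  obtain ⟨P, hPc, hPP, hPs, hPg⟩ := exists_continuous_sqrt_mul_star r
  have hdet : ∀ A, A.det ≠ 0 → (P A).det ≠ 0 := fun A hA h => by
    -- Determinants of P² = A A*: det(P)² = det A · conj(det A), nonzero when det A is.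
    have h1 := congrArg Matrix.det (hPP A)
    rw [Matrix.det_mul, Matrix.det_mul, h, Matrix.star_eq_conjTranspose,
      Matrix.det_conjTranspose] at h1
    simp [hA] at h1
  have hinv : ∀ A, A.det ≠ 0 → (P A)⁻¹ * P A = 1 := fun A hA =>
    Matrix.nonsing_inv_mul _ (isUnit_iff_ne_zero.2 (hdet A hA))
  have hinv' : ∀ A, A.det ≠ 0 → P A * (P A)⁻¹ = 1 := fun A hA =>
    Matrix.mul_nonsing_inv _ (isUnit_iff_ne_zero.2 (hdet A hA))
  have hmem : ∀ A, A.det ≠ 0 → (P A)⁻¹ * A ∈ Matrix.unitaryGroup (Fin r) ℂ := fun A hA => by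
    have hs : star (P A)⁻¹ = (P A)⁻¹ := by
      rw [Matrix.star_eq_conjTranspose, Matrix.conjTranspose_nonsing_inv,
        ← Matrix.star_eq_conjTranspose, hPs]
    rw [Matrix.mem_unitaryGroup_iff, star_mul, hs, mul_assoc, ← mul_assoc A, ← hPP, mul_assoc,
      hinv' A hA, mul_one, hinv A hA]
  classical
  -- The unitary factor is P(A)⁻¹ A. The value 1 at singular matrices is arbitrary; both claims
  -- concern invertible ones only.
  refine ⟨fun A => if hA : A.det ≠ 0 then ⟨_, hmem A hA⟩ else 1, ?_, ?_⟩
  · rw [continuousOn_iff_continuous_domRestrict, Topology.IsInducing.subtypeVal.continuous_iff]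
    have : Continuous fun A : {A : Matrix (Fin r) (Fin r) ℂ | A.det ≠ 0} => (P A)⁻¹ * A.1 := by
      simp only [Matrix.inv_def, Ring.inverse_eq_inv']
      have h1 : Continuous fun A : {A : Matrix (Fin r) (Fin r) ℂ | A.det ≠ 0} => P A :=
        hPc.comp continuous_subtype_val
      exact ((h1.matrix_det.inv₀ fun A => hdet _ A.2).smul h1.matrix_adjugate).mul
        continuous_subtype_val
    refine this.congr fun A => ?_
    have hA : A.1.det ≠ 0 := A.2
    simp [hA]
  · intro A g hA
    have hA' : (A * g.1).det ≠ 0 := by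
      rw [Matrix.det_mul]
      exact mul_ne_zero hA (Matrix.UnitaryGroup.det_isUnit g).ne_zero
    refine Subtype.ext ?_
    simp only [dif_pos hA, dif_pos hA', hPg, Submonoid.coe_mul, mul_assoc]

/-! ### Colimit topologies and continuity of the actions -/

/-- A map out of the product of a colimit with a locally compact space is continuous as soon as
its restrictions to the stages of the colimit are. -/
theorem continuous_uncurry_of_iSup_coinduced {X Y Z : Type*} {A : ℕ → Type*}
    [∀ s, TopologicalSpace (A s)] [tX : TopologicalSpace X] [TopologicalSpace Y]
    [TopologicalSpace Z] [LocallyCompactSpace Y] (i : ∀ s, A s → X)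
    (htop : tX = ⨆ s, TopologicalSpace.coinduced (i s) inferInstance)
    (hsurj : ∀ x, ∃ s u, i s u = x) (g : X → Y → Z)
    (hg : ∀ s, Continuous fun p : A s × Y => g (i s p.1) p.2) :
    Continuous fun p : X × Y => g p.1 p.2 := by
  have hx : ∀ x, Continuous (g x) := fun x => by
    obtain ⟨s, u, rfl⟩ := hsurj x
    exact (hg s).comp (Continuous.prodMk_right u)
  -- Curried into C(Y, Z) with the compact-open topology, the map has only the colimit as its
  -- source, so the stages suffice. Local compactness of Y allows uncurrying back.
  let G : X → C(Y, Z) := fun x => ⟨g x, hx x⟩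
  have hG : Continuous G := by
    rw [htop, continuous_iSup_dom]
    intro s
    rw [continuous_coinduced_dom]
    exact ContinuousMap.continuous_of_continuous_uncurry _ (hg s)
  exact ContinuousMap.continuous_uncurry_of_continuous ⟨G, hG⟩

theorem continuous_incl (s : ℕ) : Continuous (incl s) :=
  continuous_iSup_rng (i := s) continuous_coinduced_rng

theorem continuous_stiefelIncl (r s : ℕ) : Continuous (stiefelIncl r s) :=
  continuous_iSup_rng (i := s) continuous_coinduced_rng

theorem continuous_cInf_dom {Z : Type*} [TopologicalSpace Z] {g : CInf → Z}
    (hg : ∀ s, Continuous fun z => g (incl s z)) : Continuous g :=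
  continuous_iSup_dom.2 fun s => continuous_coinduced_dom.2 (hg s)

theorem continuous_stiefel_dom {r : ℕ} {Z : Type*} [TopologicalSpace Z] {g : Stiefel r → Z}
    (hg : ∀ s, Continuous fun v => g (stiefelIncl r s v)) : Continuous g :=
  continuous_iSup_dom.2 fun s => continuous_coinduced_dom.2 (hg s)

/-- A map into `V_{r,∞}` is continuous if it is given by frames that vary continuously inside a
finite stage. -/
theorem continuous_stiefel_rng {r s : ℕ} {Y : Type*} [TopologicalSpace Y] {g : Y → Stiefel r}
    (h : Y → Fin r → EuclideanSpace ℂ (Fin s)) (hc : Continuous h)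
    (hgh : ∀ y i, incl s (h y i) = (g y).1 i) : Continuous g := by
  have ho : ∀ y, Orthonormal ℂ (h y) := fun y => by
    rw [orthonormal_iff_ite]
    intro i j
    rw [← herm_incl, hgh, hgh, (g y).2]
  have : g = fun y => stiefelIncl r s ⟨h y, ho y⟩ :=
    funext fun y => Stiefel.ext (funext fun i => (hgh y i).symm)
  rw [this]
  exact (continuous_stiefelIncl r s).comp (hc.subtype_mk ho)

theorem continuous_frame {r : ℕ} (i : Fin r) : Continuous fun v : Stiefel r => v.1 i :=
  continuous_stiefel_dom fun s =>
    (continuous_incl s).comp ((continuous_apply i).comp continuous_subtype_val)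

/-- On each stage the form is linear on a finite-dimensional space. Fixing one variable is enough,
because the charts compare varying vectors with a fixed frame. -/
theorem continuous_herm (z : CInf) : Continuous (herm z) :=
  continuous_cInf_dom fun s => ((hermL z).comp (incl s)).continuous_of_finiteDimensional

/-- U(r) is closed in a finite-dimensional space. This makes it admissible as the second factor in
the exponential law. -/
theorem locallyCompactSpace_unitary (r : ℕ) : LocallyCompactSpace (U r) := by
  have h : IsClosed ((Matrix.unitaryGroup (Fin r) ℂ : Submonoid _) :
      Set (Matrix (Fin r) (Fin r) ℂ)) := by
    have : ((Matrix.unitaryGroup (Fin r) ℂ : Submonoid _) : Set (Matrix (Fin r) (Fin r) ℂ)) =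
        {A | A * star A = 1} := Set.ext fun A => Matrix.mem_unitaryGroup_iff
    rw [this]
    exact isClosed_eq (by fun_prop) continuous_const
  have : LocallyCompactSpace (Matrix (Fin r) (Fin r) ℂ) :=
    inferInstanceAs (LocallyCompactSpace (Fin r → Fin r → ℂ))
  exact h.locallyCompactSpace

theorem continuous_right_smul (r : ℕ) :
    Continuous fun p : Stiefel r × U r => MulOpposite.op p.2 • p.1 := by
  have := locallyCompactSpace_unitary r
  refine continuous_uncurry_of_iSup_coinduced (stiefelIncl r) rfl exists_stiefelIncl
    (fun v (a : U r) => MulOpposite.op a • v) fun s => ?_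
  -- Linear combinations of vectors of ℂ^s stay in ℂ^s, so U(r) preserves each stage.
  refine continuous_stiefel_rng (s := s)
    (fun p : StiefelFin r s × U r => fun j => ∑ i, p.2.1 i j • p.1.1 i) ?_ ?_
  · refine continuous_pi fun j => continuous_finsetSum _ fun i _ => ?_
    exact ((continuous_subtype_val.comp continuous_snd).matrix_elem i j).smul
      ((continuous_apply i).comp (continuous_subtype_val.comp continuous_fst))
  · intro p j
    rw [map_sum, Stiefel.right_smul_val]
    simp only [map_smul]
    rfl

theorem continuous_comb (r : ℕ) :
    Continuous fun p : Stiefel r × (Fin r → ℂ) => ∑ i, p.2 i • p.1.1 i := by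
  refine continuous_uncurry_of_iSup_coinduced (stiefelIncl r) rfl exists_stiefelIncl
    (fun v (y : Fin r → ℂ) => ∑ i, y i • v.1 i) fun s => ?_
  have : (fun p : StiefelFin r s × (Fin r → ℂ) => ∑ i, p.2 i • (stiefelIncl r s p.1).1 i) =
      fun p => incl s (∑ i, p.2 i • p.1.1 i) := by
    funext p
    rw [map_sum]
    simp only [map_smul]
    rfl
  rw [this]
  refine (continuous_incl s).comp (continuous_finsetSum _ fun i _ => ?_)
  exact ((continuous_apply i).comp continuous_snd).smul
    ((continuous_apply i).comp (continuous_subtype_val.comp continuous_fst))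

/-- The diagonal operator by which `γ` acts on `ℂ^s`. -/
noncomputable def diagFin {n : ℕ} (γ : Zn n) (s : ℕ) (z : EuclideanSpace ℂ (Fin s)) :
    EuclideanSpace ℂ (Fin s) :=
  WithLp.toLp 2 fun k => γ.val ^ (k.1 + 1) * z k

theorem incl_diagFin {n : ℕ} (γ : Zn n) (s : ℕ) (z : EuclideanSpace ℂ (Fin s)) :
    incl s (diagFin γ s z) = repM n γ (incl s z) := by
  ext k
  rw [repM_apply]
  by_cases hk : k < s
  · rw [incl_apply s _ ⟨k, hk⟩, incl_apply s _ ⟨k, hk⟩]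
    rfl
  · rw [incl_apply_of_le _ _ k (by omega), incl_apply_of_le _ _ k (by omega), mul_zero]

theorem continuous_diagFin {n : ℕ} (γ : Zn n) (s : ℕ) : Continuous (diagFin γ s) := by
  unfold diagFin
  fun_prop

theorem continuous_repM {n : ℕ} (γ : Zn n) : Continuous (repM n γ) := by
  refine continuous_cInf_dom fun s => ?_
  simp only [← incl_diagFin]
  exact (continuous_incl s).comp (continuous_diagFin γ s)

theorem continuous_zn_smul {n r : ℕ} [NeZero n] (γ : Zn n) :
    Continuous fun v : Stiefel r => γ • v := by
  refine continuous_stiefel_dom fun s => ?_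
  refine continuous_stiefel_rng (s := s) (fun v i => diagFin γ s (v.1 i)) ?_ fun v i => ?_
  · exact continuous_pi fun i =>
      (continuous_diagFin γ s).comp ((continuous_apply i).comp continuous_subtype_val)
  · rw [incl_diagFin, Stiefel.zn_smul_val]
    rfl

theorem isQuotientMap_span (r : ℕ) :
    Topology.IsQuotientMap (Stiefel.span : Stiefel r → Grass r) :=
  ⟨⟨rfl⟩, Stiefel.span_surjective r⟩

theorem continuous_grass_smul {n r : ℕ} [NeZero n] (γ : Zn n) :
    Continuous fun N : Grass r => γ • N := by
  rw [(isQuotientMap_span r).continuous_iff]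
  have : (fun N : Grass r => γ • N) ∘ Stiefel.span = fun v : Stiefel r => (γ • v).span :=
    funext fun v => (Stiefel.span_smul γ v).symm
  rw [this]
  exact (isQuotientMap_span r).continuous.comp (continuous_zn_smul γ)

/-! ### Charts of the Grassmannian and local sections -/

/-- The matrix of Hermitian products of two frames. -/
noncomputable def crossGram {r : ℕ} (v w : Stiefel r) : Matrix (Fin r) (Fin r) ℂ :=
  Matrix.of fun i j => herm (v.1 i) (w.1 j)

theorem crossGram_self {r : ℕ} (v : Stiefel r) : crossGram v v = 1 :=
  Matrix.ext fun i j => (v.2 i j).trans (Matrix.one_apply ..).symm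

/-- Linearity in the second variable. This equivariance carries the polar factor from matrices over
to frames. -/
theorem crossGram_right_smul {r : ℕ} (v w : Stiefel r) (a : U r) :
    crossGram v (MulOpposite.op a • w) = crossGram v w * a.1 := by
  ext i j
  change herm (v.1 i) ((MulOpposite.op a • w).1 j) = _
  rw [Stiefel.right_smul_val, herm_sum_right, Matrix.mul_apply]
  exact Finset.sum_congr rfl fun k _ => mul_comm _ _

theorem continuous_crossGram {r : ℕ} (v : Stiefel r) : Continuous (crossGram v) :=
  continuous_pi fun i => continuous_pi fun j => (continuous_herm (v.1 i)).comp (continuous_frame j)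

theorem det_crossGram_ne_zero_of_span_eq {r : ℕ} (v : Stiefel r) {w w' : Stiefel r}
    (h : w.span = w'.span) (hw : (crossGram v w).det ≠ 0) : (crossGram v w').det ≠ 0 := by
  obtain ⟨a, rfl⟩ := Stiefel.exists_right_smul w w' h
  rw [crossGram_right_smul, Matrix.det_mul]
  exact mul_ne_zero hw (Matrix.UnitaryGroup.det_isUnit a).ne_zero

/-- The subspaces that project isomorphically onto the span of the frame `v`. -/
def grassChart {r : ℕ} (v : Stiefel r) : Set (Grass r) :=
  {N | ∀ w : Stiefel r, w.span = N → (crossGram v w).det ≠ 0}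

theorem span_mem_grassChart {r : ℕ} (v w : Stiefel r) :
    w.span ∈ grassChart v ↔ (crossGram v w).det ≠ 0 :=
  ⟨fun h => h w rfl, fun h _ hw' => det_crossGram_ne_zero_of_span_eq v hw'.symm h⟩

theorem span_mem_grassChart_self {r : ℕ} (v : Stiefel r) : v.span ∈ grassChart v := by
  rw [span_mem_grassChart, crossGram_self, Matrix.det_one]
  exact one_ne_zero

theorem span_preimage_grassChart {r : ℕ} (v : Stiefel r) :
    Stiefel.span ⁻¹' grassChart v = crossGram v ⁻¹' {A | A.det ≠ 0} :=
  Set.ext fun w => span_mem_grassChart v w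

theorem isOpen_grassChart {r : ℕ} (v : Stiefel r) : IsOpen (grassChart v) := by
  rw [← (isQuotientMap_span r).isOpen_preimage, span_preimage_grassChart]
  exact (isOpen_det_ne_zero r).preimage (continuous_crossGram v)

/-- Over a chart, `V_{r,∞} → G_{r,∞}` has a continuous section `σ`, and the unitary matrix that
carries `σ` to a given frame depends continuously on the frame. -/
theorem exists_section {r : ℕ} (v : Stiefel r) :
    ∃ (σ : Grass r → Stiefel r) (R : Stiefel r → U r),
      ContinuousOn σ (grassChart v) ∧ (∀ N, (σ N).span = N) ∧
      ContinuousOn R (Stiefel.span ⁻¹' grassChart v) ∧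
      ∀ w : Stiefel r, w.span ∈ grassChart v →
        w = MulOpposite.op (R w) • σ w.span := by
  obtain ⟨R, hRc, hRg⟩ := exists_polar r
  -- An arbitrary choice of frames, with no continuity; τ removes the dependence on it over the
  -- chart.
  choose s hs using Stiefel.span_surjective r
  let τ : Stiefel r → Stiefel r := fun w => MulOpposite.op (R (crossGram v w))⁻¹ • w
  have hRc' : ContinuousOn (fun w => R (crossGram v w)) (Stiefel.span ⁻¹' grassChart v) := by
    rw [span_preimage_grassChart]
    exact hRc.comp (continuous_crossGram v).continuousOn (Set.mapsTo_preimage _ _)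
  -- τ is constant on U(r)-orbits over the chart: passing from u to u·a multiplies the polar factor
  -- by a, and the two changes cancel.
  have hτ : ∀ w : Stiefel r, w.span ∈ grassChart v → τ (s w.span) = τ w := by
    intro w hw
    obtain ⟨a, ha⟩ := Stiefel.exists_right_smul (s w.span) w (hs _)
    have hd : (crossGram v (s w.span)).det ≠ 0 := hw _ (hs _)
    have : ∀ u, w = MulOpposite.op a • u → (crossGram v u).det ≠ 0 → τ u = τ w := by
      rintro u rfl hu
      simp only [τ]
      rw [crossGram_right_smul, hRg _ _ hu, smul_smul, ← MulOpposite.op_mul, mul_inv_rev,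
        mul_inv_cancel_left]
    exact this _ ha hd
  refine ⟨fun N => τ (s N), fun w => R (crossGram v w), ?_, fun N => ?_, hRc', fun w hw => ?_⟩
  -- Over an open set, continuity may be tested after composing with the quotient map, where the
  -- section becomes τ.
  · rw [(isQuotientMap_span r).continuousOn_isOpen_iff (isOpen_grassChart v)]
    refine ContinuousOn.congr (f := τ) ?_ fun w hw => hτ w hw
    have hinv : ContinuousOn (fun w => (R (crossGram v w))⁻¹) (Stiefel.span ⁻¹' grassChart v) :=
      hRc'.inv
    have hpair : ContinuousOn (fun w => (w, (R (crossGram v w))⁻¹))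
        (Stiefel.span ⁻¹' grassChart v) := continuousOn_id.prodMk hinv
    have h := Continuous.comp_continuousOn' (continuous_right_smul r) hpair
    exact h
  · rw [Stiefel.span_right_smul, hs]
  · simp only [hτ w hw, τ]
    rw [smul_smul, ← MulOpposite.op_mul, inv_mul_cancel, MulOpposite.op_one, one_smul]

/-- The action is free: the Hermitian products of v with v·a recover a. -/
theorem Stiefel.right_smul_injective {r : ℕ} (v : Stiefel r) :
    Function.Injective fun a : U r => MulOpposite.op a • v := by
  intro a b h
  have h1 := congrArg (crossGram v) h
  simp only [crossGram_right_smul, crossGram_self, one_mul] at h1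
  exact Subtype.ext h1

/-- Pairing z = ∑ y_j σ(N)_j with the fixed vectors v_i gives a linear system for y whose matrix is
invertible over the chart; Cramer's rule makes the solution continuous. The formula makes sense for
every z, in N or not. -/
theorem exists_coords {r : ℕ} (v : Stiefel r) (σ : Grass r → Stiefel r)
    (hσ : ContinuousOn σ (grassChart v)) (hσN : ∀ N, (σ N).span = N) :
    ∃ C : Grass r × CInf → Fin r → ℂ, ContinuousOn C (grassChart v ×ˢ Set.univ) ∧
      ∀ N ∈ grassChart v, ∀ y : Fin r → ℂ, C (N, ∑ i, y i • (σ N).1 i) = y := by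
  have hdet : ∀ N ∈ grassChart v, (crossGram v (σ N)).det ≠ 0 := fun N hN => hN _ (hσN N)
  refine ⟨fun p => ((crossGram v (σ p.1)).det⁻¹ • (crossGram v (σ p.1)).adjugate).mulVec
    fun i => herm (v.1 i) p.2, ?_, fun N hN y => ?_⟩
  · have hA : ContinuousOn (fun p : Grass r × CInf => crossGram v (σ p.1))
        (grassChart v ×ˢ Set.univ) :=
      (continuous_crossGram v).comp_continuousOn
        (hσ.comp continuousOn_fst fun p hp => hp.1)
    have hd := (continuous_id.matrix_det (n := Fin r) (R := ℂ)).comp_continuousOn hA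
    have had := (continuous_id.matrix_adjugate (n := Fin r) (R := ℂ)).comp_continuousOn hA
    have hM := (hd.inv₀ fun p hp => hdet p.1 hp.1).smul had
    have hz : Continuous fun p : Grass r × CInf => fun i => herm (v.1 i) p.2 :=
      continuous_pi fun i => (continuous_herm _).comp continuous_snd
    have hmul : Continuous fun q : Matrix (Fin r) (Fin r) ℂ × (Fin r → ℂ) => q.1.mulVec q.2 :=
      continuous_fst.matrix_mulVec continuous_snd
    have hpair := hM.prodMk hz.continuousOn
    have h := Continuous.comp_continuousOn' hmul hpair
    exact h
  · have : (fun i => herm (v.1 i) (∑ j, y j • (σ N).1 j)) = (crossGram v (σ N)).mulVec y := by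
      funext i
      rw [herm_sum_right]
      exact Finset.sum_congr rfl fun j _ => mul_comm _ _
    dsimp only
    rw [this, Matrix.mulVec_mulVec, Matrix.smul_mul, Matrix.adjugate_mul, smul_smul,
      inv_mul_cancel₀ (hdet N hN), one_smul, Matrix.one_mulVec]

/-! ### The principal bundle -/

theorem exists_principal_trivialization {r : ℕ} (v : Stiefel r) :
    ∃ e : Trivialization (U r) (Stiefel.span : Stiefel r → Grass r), v.span ∈ e.baseSet ∧
      ∀ w : Stiefel r, w.span ∈ e.baseSet → ∀ g : U r,
        (e (MulOpposite.op g • w)).2 = (e w).2 * g := by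
  obtain ⟨σ, R, hσ, hσN, hR, hw⟩ := exists_section v
  -- By freeness, the matrix carrying σ(N) to a frame is unique; this also yields the equivariance
  -- of R.
  have hRσ : ∀ N ∈ grassChart v, ∀ a : U r, R (MulOpposite.op a • σ N) = a := by
    intro N hN a
    have hs : (MulOpposite.op a • σ N).span = N := by rw [Stiefel.span_right_smul, hσN]
    have h := hw (MulOpposite.op a • σ N) (by rwa [hs])
    rw [hs] at h
    exact ((σ N).right_smul_injective h).symm
  let e : Trivialization (U r) (Stiefel.span : Stiefel r → Grass r) :=
    { toFun := fun w => (w.span, R w)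
      invFun := fun p => MulOpposite.op p.2 • σ p.1
      source := Stiefel.span ⁻¹' grassChart v
      target := grassChart v ×ˢ Set.univ
      map_source' := fun w h => ⟨h, trivial⟩
      map_target' := fun p h => by
        rw [Set.mem_preimage, Stiefel.span_right_smul, hσN]
        exact h.1
      left_inv' := fun w h => (hw w h).symm
      right_inv' := fun p h => Prod.ext (by rw [Stiefel.span_right_smul, hσN]) (hRσ _ h.1 _)
      open_source := (isOpen_grassChart v).preimage (isQuotientMap_span r).continuous
      open_target := (isOpen_grassChart v).prod isOpen_univ
      continuousOn_toFun := (isQuotientMap_span r).continuous.continuousOn.prodMk hR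
      continuousOn_invFun := by
        have hpair : ContinuousOn (fun p : Grass r × U r => (σ p.1, p.2))
            (grassChart v ×ˢ Set.univ) :=
          (hσ.comp continuousOn_fst fun p hp => hp.1).prodMk continuousOn_snd
        have h := Continuous.comp_continuousOn' (continuous_right_smul r) hpair
        exact h
      baseSet := grassChart v
      open_baseSet := isOpen_grassChart v
      source_eq := rfl
      target_eq := rfl
      proj_toFun := fun _ _ => rfl }
  refine ⟨e, span_mem_grassChart_self v, fun w h g => ?_⟩
  change R (MulOpposite.op g • w) = R w * g
  conv_lhs => rw [hw w h]
  rw [smul_smul, ← MulOpposite.op_mul]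
  exact hRσ _ h _

theorem isEquivariantPrincipalBundle_span (n r : ℕ) [NeZero n] :
    IsEquivariantPrincipalBundle (Zn n) (U r) (Stiefel.span : Stiefel r → Grass r) where
  continuous_proj := (isQuotientMap_span r).continuous
  continuous_smul_base := continuous_grass_smul
  continuous_smul := continuous_zn_smul
  continuous_right_smul := continuous_right_smul r
  proj_smul := Stiefel.span_smul
  proj_right_smul := Stiefel.span_right_smul
  smul_right_smul := Stiefel.smul_right_smul
  locally_trivial N := by
    obtain ⟨v, rfl⟩ := Stiefel.span_surjective r N
    exact exists_principal_trivialization v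

/-! ### The tautological bundle -/

theorem Stiefel.comb_mem_span {r : ℕ} (v : Stiefel r) (y : Fin r → ℂ) :
    ∑ i, y i • v.1 i ∈ v.span.1 :=
  (Submodule.mem_span_range_iff_exists_fun ℂ).2 ⟨y, rfl⟩

theorem Stiefel.exists_comb {r : ℕ} (v : Stiefel r) {z : CInf} (hz : z ∈ v.span.1) :
    ∃ y : Fin r → ℂ, ∑ i, y i • v.1 i = z :=
  (Submodule.mem_span_range_iff_exists_fun ℂ).1 hz

theorem Stiefel.comb_injective {r : ℕ} (v : Stiefel r) :
    Function.Injective fun y : Fin r → ℂ => ∑ i, y i • v.1 i := fun y z h =>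
  funext fun i => by
    rw [← v.herm_comb y i, ← v.herm_comb z i]
    exact congrArg (herm (v.1 i)) h

theorem isInducing_tautToProd (r : ℕ) : Topology.IsInducing (tautToProd r) := ⟨rfl⟩

theorem continuous_tautToProd (r : ℕ) : Continuous (tautToProd r) :=
  (isInducing_tautToProd r).continuous

theorem continuous_taut_proj (r : ℕ) :
    Continuous (TotalSpace.proj : TotalSpace (Fin r → ℂ) (TautFibre r) → Grass r) :=
  continuous_fst.comp (continuous_tautToProd r)

theorem exists_taut_trivialization {r : ℕ} (v : Stiefel r) :
    ∃ e : Trivialization (Fin r → ℂ)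
        (TotalSpace.proj : TotalSpace (Fin r → ℂ) (TautFibre r) → Grass r),
      v.span ∈ e.baseSet ∧ e.IsLinear ℂ := by
  obtain ⟨σ, -, hσ, hσN, -, -⟩ := exists_section v
  obtain ⟨C, hC, hCσ⟩ := exists_coords v σ hσ hσN
  have hmem : ∀ (N : Grass r) (y : Fin r → ℂ), ∑ i, y i • (σ N).1 i ∈ N.1 := fun N y => by
    have h := (σ N).comb_mem_span y
    rwa [hσN] at h
  have hex : ∀ (N : Grass r), ∀ z ∈ N.1, ∃ y : Fin r → ℂ, ∑ i, y i • (σ N).1 i = z :=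
    fun N z hz => (σ N).exists_comb (by rwa [hσN])
  let e : Trivialization (Fin r → ℂ)
      (TotalSpace.proj : TotalSpace (Fin r → ℂ) (TautFibre r) → Grass r) :=
    { toFun := fun x => (x.1, C (tautToProd r x))
      invFun := fun p => ⟨p.1, ⟨∑ i, p.2 i • (σ p.1).1 i, hmem p.1 p.2⟩⟩
      source := TotalSpace.proj ⁻¹' grassChart v
      target := grassChart v ×ˢ Set.univ
      map_source' := fun w h => ⟨h, trivial⟩
      map_target' := fun p h => h.1
      left_inv' := by
        rintro ⟨N, z, hz⟩ h
        obtain ⟨y, rfl⟩ := hex N z hz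
        refine tautToProd_injective r (Prod.ext rfl ?_)
        change ∑ i, C (N, ∑ i, y i • (σ N).1 i) i • (σ N).1 i = ∑ i, y i • (σ N).1 i
        rw [hCσ N h]
      right_inv' := fun p h => Prod.ext rfl (hCσ p.1 h.1 p.2)
      open_source := (isOpen_grassChart v).preimage (continuous_taut_proj r)
      open_target := (isOpen_grassChart v).prod isOpen_univ
      continuousOn_toFun := (continuous_taut_proj r).continuousOn.prodMk
        (hC.comp (continuous_tautToProd r).continuousOn fun x hx => ⟨hx, trivial⟩)
      continuousOn_invFun := by
        rw [(isInducing_tautToProd r).continuousOn_iff]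
        have hpair : ContinuousOn (fun p : Grass r × (Fin r → ℂ) => (σ p.1, p.2))
            (grassChart v ×ˢ Set.univ) :=
          (hσ.comp continuousOn_fst fun p hp => hp.1).prodMk continuousOn_snd
        have h := Continuous.comp_continuousOn' (continuous_comb r) hpair
        exact continuousOn_fst.prodMk h
      baseSet := grassChart v
      open_baseSet := isOpen_grassChart v
      source_eq := rfl
      target_eq := rfl
      proj_toFun := fun _ _ => rfl }
  -- On the fibre over N, C inverts the linear map y ↦ ∑ y_i σ(N)_i, hence is linear.
  refine ⟨e, span_mem_grassChart_self v, ⟨fun N hN => ⟨?_, ?_⟩⟩⟩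
  · rintro ⟨z, hz⟩ ⟨z', hz'⟩
    obtain ⟨y, rfl⟩ := hex N z hz
    obtain ⟨y', rfl⟩ := hex N z' hz'
    change C (N, ∑ i, y i • (σ N).1 i + ∑ i, y' i • (σ N).1 i) =
      C (N, ∑ i, y i • (σ N).1 i) + C (N, ∑ i, y' i • (σ N).1 i)
    have : ∑ i, y i • (σ N).1 i + ∑ i, y' i • (σ N).1 i = ∑ i, (y + y') i • (σ N).1 i := by
      simp only [Pi.add_apply, add_smul, Finset.sum_add_distrib]
    rw [this, hCσ N hN, hCσ N hN, hCσ N hN]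
  · rintro c ⟨z, hz⟩
    obtain ⟨y, rfl⟩ := hex N z hz
    change C (N, c • ∑ i, y i • (σ N).1 i) = c • C (N, ∑ i, y i • (σ N).1 i)
    have : c • ∑ i, y i • (σ N).1 i = ∑ i, (c • y) i • (σ N).1 i := by
      simp only [Pi.smul_apply, smul_eq_mul, mul_smul, Finset.smul_sum]
    rw [this, hCσ N hN, hCσ N hN]

theorem isEquivariantVectorBundle_taut (n r : ℕ) [NeZero n] :
    IsEquivariantVectorBundle (Zn n) (Fin r → ℂ) (TautFibre r) where
  continuous_proj := continuous_taut_proj r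
  locally_trivial N := by
    obtain ⟨v, rfl⟩ := Stiefel.span_surjective r N
    exact exists_taut_trivialization v
  continuous_smul_base := continuous_grass_smul
  continuous_smul γ := by
    rw [(isInducing_tautToProd r).continuous_iff]
    exact ((continuous_grass_smul γ).comp (continuous_taut_proj r)).prodMk
      ((continuous_repM γ).comp (continuous_snd.comp (continuous_tautToProd r)))
  smul_linear γ N := ⟨(repM n γ).restrict fun _ hz => Submodule.mem_map_of_mem hz, fun _ => rfl⟩

/-! ### The isomorphism f -/

/-- The map `[v, y] ↦ (⟨v_1, …, v_r⟩, ∑ i, y_i v_i)`. -/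
noncomputable def assocToTaut (r : ℕ) (q : Assoc r) : TotalSpace (Fin r → ℂ) (TautFibre r) :=
  Quotient.lift (fun p : Stiefel r × (Fin r → ℂ) =>
    (⟨p.1.span, ⟨∑ i, p.2 i • p.1.1 i, p.1.comb_mem_span p.2⟩⟩ :
      TotalSpace (Fin r → ℂ) (TautFibre r))) (by
    rintro ⟨v, y⟩ ⟨w, z⟩ ⟨a, h1, h2⟩
    dsimp only at h1 h2
    subst h1 h2
    refine tautToProd_injective r (Prod.ext (Stiefel.span_right_smul w a) ?_)
    change ∑ j, y j • (MulOpposite.op a • w).1 j = ∑ i, a.1.mulVec y i • w.1 i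
    simp only [Stiefel.right_smul_val, Finset.smul_sum, Matrix.mulVec, dotProduct,
      Finset.sum_smul]
    rw [Finset.sum_comm]
    refine Finset.sum_congr rfl fun i _ => Finset.sum_congr rfl fun j _ => ?_
    rw [smul_smul, mul_comm]) q

theorem tautToProd_assocToTaut_mk {r : ℕ} (v : Stiefel r) (y : Fin r → ℂ) :
    tautToProd r (assocToTaut r (Assoc.mk v y)) = (v.span, ∑ i, y i • v.1 i) := rfl

theorem Assoc.exists_mk {r : ℕ} (q : Assoc r) : ∃ v y, Assoc.mk v y = q := by
  induction q using Quotient.inductionOn with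
  | h p => exact ⟨p.1, p.2, rfl⟩

/-- Allows all classes over one subspace to be compared in a common frame. -/
theorem Assoc.exists_mk_of_proj_eq {r : ℕ} (q : Assoc r) (v : Stiefel r) (h : q.proj = v.span) :
    ∃ y, Assoc.mk v y = q := by
  obtain ⟨y, hy⟩ := (frameEquiv v v.span rfl).surjective ⟨q, h⟩
  exact ⟨y, congrArg AssocFibre.point hy⟩

theorem continuous_assocMk (r : ℕ) :
    Continuous fun p : Stiefel r × (Fin r → ℂ) => Assoc.mk p.1 p.2 :=
  continuous_quotient_mk'

theorem continuous_assocToTaut (r : ℕ) : Continuous (assocToTaut r) := by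
  refine Continuous.quotient_lift ?_ _
  rw [(isInducing_tautToProd r).continuous_iff]
  exact ((isQuotientMap_span r).continuous.comp continuous_fst).prodMk (continuous_comb r)

theorem assocToTaut_bijective (r : ℕ) : Function.Bijective (assocToTaut r) := by
  constructor
  · intro q q' h
    obtain ⟨v, y, rfl⟩ := q.exists_mk
    have h' := congrArg (tautToProd r) h
    have hp : q'.proj = v.span := by
      obtain ⟨w, z, rfl⟩ := q'.exists_mk
      exact (congrArg Prod.fst h').symm
    obtain ⟨z, rfl⟩ := q'.exists_mk_of_proj_eq v hp
    exact congrArg (Assoc.mk v) (v.comb_injective (congrArg Prod.snd h'))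
  · rintro ⟨N, z, hz⟩
    obtain ⟨v, rfl⟩ := Stiefel.span_surjective r N
    obtain ⟨y, rfl⟩ := v.exists_comb hz
    exact ⟨Assoc.mk v y, rfl⟩

/-- Near each point the inverse is (N, z) ↦ [σ(N), C(N, z)], a composite of continuous maps. Local
triviality of the associated bundle is not needed. -/
theorem isHomeomorph_assocToTaut (r : ℕ) : IsHomeomorph (assocToTaut r) := by
  let e := Equiv.ofBijective _ (assocToTaut_bijective r)
  suffices h : Continuous e.symm from
    (⟨e, continuous_assocToTaut r, h⟩ : Assoc r ≃ₜ _).isHomeomorph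
  rw [continuous_iff_continuousAt]
  intro x
  obtain ⟨v, hv⟩ := Stiefel.span_surjective r x.1
  obtain ⟨σ, -, hσ, hσN, -, -⟩ := exists_section v
  obtain ⟨C, hC, hCσ⟩ := exists_coords v σ hσ hσN
  have hO : IsOpen (TotalSpace.proj ⁻¹' grassChart v :
      Set (TotalSpace (Fin r → ℂ) (TautFibre r))) :=
    (isOpen_grassChart v).preimage (continuous_taut_proj r)
  have hx : x ∈ (TotalSpace.proj ⁻¹' grassChart v :
      Set (TotalSpace (Fin r → ℂ) (TautFibre r))) := by
    rw [Set.mem_preimage, ← hv]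
    exact span_mem_grassChart_self v
  refine ContinuousOn.continuousAt ?_ (hO.mem_nhds hx)
  have hpair : ContinuousOn (fun x : TotalSpace (Fin r → ℂ) (TautFibre r) =>
      (σ x.1, C (tautToProd r x))) (TotalSpace.proj ⁻¹' grassChart v) :=
    (hσ.comp (continuous_taut_proj r).continuousOn fun x hx => hx).prodMk
      (hC.comp (continuous_tautToProd r).continuousOn fun x hx => ⟨hx, trivial⟩)
  have h := Continuous.comp_continuousOn' (continuous_assocMk r) hpair
  refine h.congr ?_
  rintro ⟨N, z, hz⟩ hN
  obtain ⟨y, rfl⟩ := (σ N).exists_comb (z := z) (by rwa [hσN])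
  rw [Equiv.symm_apply_eq]
  refine tautToProd_injective r (Prod.ext (hσN N).symm ?_)
  change ∑ i, y i • (σ N).1 i = ∑ i, C (N, ∑ i, y i • (σ N).1 i) i • (σ N).1 i
  rw [hCσ N hN]

theorem assocToTaut_smul {n r : ℕ} [NeZero n] (γ : Zn n) (q : Assoc r) :
    assocToTaut r (γ • q) = γ • assocToTaut r q := by
  obtain ⟨v, y, rfl⟩ := q.exists_mk
  refine tautToProd_injective r (Prod.ext (Stiefel.span_smul γ v) ?_)
  change ∑ i, y i • (γ • v).1 i = repM n γ (∑ i, y i • v.1 i)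
  simp only [map_sum, map_smul, Stiefel.zn_smul_val]

theorem isHomeomorph_assocTotalEquiv (r : ℕ) : IsHomeomorph (assocTotalEquiv r) :=
  ((assocTotalEquiv r).toHomeomorphOfIsInducing ⟨rfl⟩).isHomeomorph

theorem assocToTaut_fibre_linear {r : ℕ} (N : Grass r) :
    ∃ L : AssocFibre r N ≃ₗ[ℂ] TautFibre r N, ∀ x : AssocFibre r N,
      assocToTaut r x.1 = ⟨N, L x⟩ := by
  obtain ⟨v, rfl⟩ := Stiefel.span_surjective r N
  have hex : ∀ x : AssocFibre r v.span, ∃ y, AssocFibre.ofFrame v y = x := fun x => by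
    obtain ⟨y, hy⟩ := x.1.exists_mk_of_proj_eq v x.2
    exact ⟨y, AssocFibre.ext hy⟩
  -- y x is the coordinate vector of x in the frame v; it is unique, and additive and homogeneous by
  -- `AssocFibre.ofFrame_add` and `AssocFibre.ofFrame_smul`.
  choose y hy using hex
  have hinj : ∀ a b, AssocFibre.ofFrame v a = AssocFibre.ofFrame v b → a = b := fun a b h =>
    (frameEquiv v v.span rfl).injective h
  have hyof : ∀ a, y (AssocFibre.ofFrame v a) = a := fun a => hinj _ _ (hy _)
  let l : AssocFibre r v.span →ₗ[ℂ] TautFibre r v.span :=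
    { toFun := fun x => ⟨∑ i, y x i • v.1 i, v.comb_mem_span _⟩
      map_add' := fun x x' => by
        refine Subtype.ext ?_
        have h : y (x + x') = y x + y x' := by
          conv_lhs => rw [← hy x, ← hy x', AssocFibre.ofFrame_add, hyof]
        change ∑ i, y (x + x') i • v.1 i = ∑ i, y x i • v.1 i + ∑ i, y x' i • v.1 i
        simp only [h, Pi.add_apply, add_smul, Finset.sum_add_distrib]
      map_smul' := fun c x => by
        refine Subtype.ext ?_
        have h : y (c • x) = c • y x := by
          conv_lhs => rw [← hy x, AssocFibre.ofFrame_smul, hyof]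
        change ∑ i, y (c • x) i • v.1 i = c • ∑ i, y x i • v.1 i
        simp only [h, Pi.smul_apply, smul_eq_mul, mul_smul, Finset.smul_sum] }
  refine ⟨LinearEquiv.ofBijective l ⟨fun x x' h => ?_, fun z => ?_⟩, fun x => ?_⟩
  · rw [← hy x, ← hy x', v.comb_injective (congrArg Subtype.val h)]
  · obtain ⟨a, ha⟩ := v.exists_comb z.2
    refine ⟨AssocFibre.ofFrame v a, Subtype.ext ?_⟩
    change ∑ i, y (AssocFibre.ofFrame v a) i • v.1 i = z
    rw [hyof, ha]
  · conv_lhs => rw [← hy x]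
    rfl

theorem isEquivariantVectorBundleIso_assocToTaut (n r : ℕ) [NeZero n] :
    IsEquivariantVectorBundleIso (Zn n)
      (fun x : TotalSpace (Fin r → ℂ) (AssocFibre r) => assocToTaut r (assocTotalEquiv r x)) where
  isHomeomorph := (isHomeomorph_assocToTaut r).comp (isHomeomorph_assocTotalEquiv r)
  fibre_linear := assocToTaut_fibre_linear
  equivariant γ x := by
    rw [← assocToTaut_smul]
    exact congrArg (assocToTaut r) ((assocTotalEquiv r).apply_symm_apply _)

/-! ### Transport of the bundle structure and conclusion -/

/-- The property of being an equivariant vector bundle is transported along isomorphisms. -/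
theorem IsEquivariantVectorBundle.of_iso {Γ : Type*} [Group Γ] {B : Type*} [TopologicalSpace B]
    [MulAction Γ B] {F : Type*} [NormedAddCommGroup F] [NormedSpace ℂ F] {E E' : B → Type*}
    [∀ b, AddCommGroup (E b)] [∀ b, Module ℂ (E b)]
    [∀ b, AddCommGroup (E' b)] [∀ b, Module ℂ (E' b)]
    [TopologicalSpace (TotalSpace F E)] [TopologicalSpace (TotalSpace F E')]
    [MulAction Γ (TotalSpace F E)] [MulAction Γ (TotalSpace F E')]
    {f : TotalSpace F E → TotalSpace F E'} (hf : IsEquivariantVectorBundleIso Γ f)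
    (h : IsEquivariantVectorBundle Γ F E') : IsEquivariantVectorBundle Γ F E := by
  have hproj : (TotalSpace.proj : TotalSpace F E → B) = TotalSpace.proj ∘ f := by
    funext ⟨b, x⟩
    obtain ⟨L, hL⟩ := hf.fibre_linear b
    rw [Function.comp_apply, hL]
  refine ⟨?_, fun b => ?_, h.continuous_smul_base, fun γ => ?_, fun γ b => ?_⟩
  · rw [hproj]
    exact h.continuous_proj.comp hf.isHomeomorph.continuous
  · obtain ⟨e, hb, he⟩ := h.locally_trivial b
    -- f covers the identity only up to a propositional equality of projections, so the projection
    -- is made a variable before pulling back the trivialization.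
    have key : ∀ p (hp : p = TotalSpace.proj ∘ f), ∃ e' : Trivialization F p,
        e'.baseSet = e.baseSet ∧ ∀ x, e' x = e (f x) := by
      rintro p rfl
      exact ⟨e.compHomeomorph hf.isHomeomorph.homeomorph, rfl, fun x => rfl⟩
    obtain ⟨e', hb', he'⟩ := key _ hproj
    refine ⟨e', hb' ▸ hb, ⟨fun c hc => ?_⟩⟩
    obtain ⟨L, hL⟩ := hf.fibre_linear c
    simp only [he', hL]
    exact (((e.linear ℂ (hb' ▸ hc)).mk' _).comp L.toLinearMap).isLinear
  · have : f ∘ (fun x => γ • x) = (fun x => γ • x) ∘ f := funext fun x => hf.equivariant γ x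
    rw [hf.isHomeomorph.isInducing.continuous_iff, this]
    exact (h.continuous_smul γ).comp hf.isHomeomorph.continuous
  · obtain ⟨L, hL⟩ := hf.fibre_linear b
    obtain ⟨L', hL'⟩ := hf.fibre_linear (γ • b)
    obtain ⟨S, hS⟩ := h.smul_linear γ b
    -- The action on the fibres of E is that on E', conjugated by f.
    refine ⟨L'.symm.toLinearMap ∘ₗ S ∘ₗ L.toLinearMap, fun x => hf.isHomeomorph.injective ?_⟩
    rw [hf.equivariant, hL, hS, hL']
    simp

end SegalBundle

theorem theorem4p1 (n r : ℕ) [NeZero n] :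
    IsEquivariantPrincipalBundle (Zn n) (U r) (Stiefel.span : Stiefel r → Grass r) ∧
    IsEquivariantVectorBundle (Zn n) (Fin r → ℂ) (AssocFibre r) ∧
    IsEquivariantVectorBundle (Zn n) (Fin r → ℂ) (TautFibre r) ∧
    ∃ f : TotalSpace (Fin r → ℂ) (AssocFibre r) → TotalSpace (Fin r → ℂ) (TautFibre r),
      IsEquivariantVectorBundleIso (Zn n) f ∧
      ∀ (v : Stiefel r) (y : Fin r → ℂ),
        tautToProd r (f ((assocTotalEquiv r).symm (Assoc.mk v y))) =
          (v.span, ∑ i, y i • v.1 i) :=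
  ⟨isEquivariantPrincipalBundle_span n r,
    (isEquivariantVectorBundle_taut n r).of_iso (isEquivariantVectorBundleIso_assocToTaut n r),
    isEquivariantVectorBundle_taut n r, _, isEquivariantVectorBundleIso_assocToTaut n r,
    tautToProd_assocToTaut_mk⟩
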